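/- Let $f(x)=\sum_{i=0}^n a_i x^i\in\mathbb Z[x]$ with $a_0a_n\neq 0$, and let $p$ be a prime. To every nonzero coefficient $a_i$ assign the point $(i,\alpha_i)$, where $p^{\alpha_i}$ is the exact power of $p$ dividing $a_i$. Let $P_0=(0,\alpha_0)$ and, as long as $P_k=(i_k,\alpha_{i_k})$ has $i_k<n$, let $P_{k+1}=(i_{k+1},\alpha_{i_{k+1}})$, where $i_{k+1}>i_k$ is the largest index for which no assigned point lies below the line $P_kP_{k+1}$; the last point is $(n,\alpha_n)$. The Newton diagram of $f$ with respect to $p$ is this broken line, with all points with integer coordinates on it taken as its vertices; its segments join consecutive vertices. Call $f$ a Dumas polynomial if $a_0a_n\ne0$ and for some prime $p$ its Newton diagram with respect to $p$ consists of precisely one segment. For integers $n\ge 2$ and $H\ge 1$, let $\mathcal P_n(H)$ be the number of polynomials in $\mathbb Z[x]$ of degree exactly $n$ all of whose coefficients have absolute value at most $H$; let $\mathcal I_n(H)$ be the number of those that are irreducible over $\mathbb Q$, and $\mathcal D_n(H)$ the number of those that are Dumas polynomials. Put $$\tau_n=\begin{cases}1-\prod_{p\text{ prime}}\left(1-\frac1p\right)^2\left(1+\frac2p\right),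 & n=2,\\[1mm] 1-\frac1{\zeta(n-1)}, & n\ge 3.\end{cases}$$ Then for every $n\ge 2$, $$\limsup_{H\to\infty}\frac{\mathcal D_n(H)}{\mathcal P_n(H)}=\limsup_{H\to\infty}\frac{\mathcal D_n(H)}{\mathcal I_n(H)}\le\tau_n<1.$$ In particular, $\mathcal D_n(H)/\mathcal I_n(H)$ does not tend to $1$ as $H\to\infty$: Dumas polynomials do not have density $1$ among irreducible polynomials. -/

import Mathlib

open scoped Polynomial

noncomputable section

namespace DumasCount

/-- The height of an integer polynomial: the largest absolute value of its coefficients. -/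
def height (f : ℤ[X]) : ℕ :=
  (Finset.range (f.natDegree + 1)).sup fun i => (f.coeff i).natAbs

/-- The second coordinate `α` of the point `(i, α)` attached to a nonzero coefficient of `f`:
the exponent of the prime `p` in the coefficient of `x ^ i`. (Used only for `i ∈ f.support`.) -/
def expo (p : ℕ) (f : ℤ[X]) (i : ℕ) : ℤ :=
  (padicValInt p (f.coeff i) : ℤ)

/-- For `i < j`: no point `(k, α_k)` attached to a nonzero coefficient of `f` lies below the line
through `(i, α_i)` and `(j, α_j)`. The inequality
`α_i + (α_j - α_i) / (j - i) * (k - i) ≤ α_k` is multiplied by `j - i > 0`. -/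
def NoPointBelow (p : ℕ) (f : ℤ[X]) (i j : ℕ) : Prop :=
  ∀ k ∈ f.support,
    (expo p f j - expo p f i) * ((k : ℤ) - i) ≤ (expo p f k - expo p f i) * ((j : ℤ) - i)

/-- The vertex `(j, α_j)` follows the vertex `(i, α_i)` on the broken line `P₀ P₁ ⋯ P_r`:
`j` is the largest index such that no point lies below the line through these two points. -/
def IsNext (p : ℕ) (f : ℤ[X]) (i j : ℕ) : Prop :=
  IsGreatest {j : ℕ | j ∈ f.support ∧ i < j ∧ NoPointBelow p f i j} j

/-- The abscissae of the vertices `P₀, P₁, …, P_r` of the broken line, which starts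
at `P₀ = (0, α_0)`. -/
inductive IsVertex (p : ℕ) (f : ℤ[X]) : ℕ → Prop
  | start : IsVertex p f 0
  | step (i j : ℕ) : IsVertex p f i → IsNext p f i j → IsVertex p f j

/-- The vertices `Q₀, Q₁, …, Q_{r+s}` of the Newton diagram of `f` with respect to `p`: all points
with integer coordinates on the segments of the broken line `P₀ P₁ ⋯ P_r`. -/
def diagramVertices (p : ℕ) (f : ℤ[X]) : Set (ℤ × ℤ) :=
  {Q | ∃ i j : ℕ, IsVertex p f i ∧ IsNext p f i j ∧ (i : ℤ) ≤ Q.1 ∧ Q.1 ≤ j ∧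
    (Q.2 - expo p f i) * ((j : ℤ) - i) = (expo p f j - expo p f i) * (Q.1 - i)}

/-- The segments `Q_t Q_{t+1}` of the Newton diagram of `f` with respect to `p`, each given by its
left and its right end point: two consecutive vertices of the diagram. -/
def diagramSegments (p : ℕ) (f : ℤ[X]) : Set ((ℤ × ℤ) × (ℤ × ℤ)) :=
  {S | S.1 ∈ diagramVertices p f ∧ S.2 ∈ diagramVertices p f ∧ S.1.1 < S.2.1 ∧
    ∀ R ∈ diagramVertices p f, ¬ (S.1.1 < R.1 ∧ R.1 < S.2.1)}

/-- Dumas polynomials: the leading and the constant coefficient are nonzero, and for some prime `p`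
the Newton diagram with respect to `p` consists of precisely one segment. -/
def IsDumas (f : ℤ[X]) : Prop :=
  f.leadingCoeff ≠ 0 ∧ f.coeff 0 ≠ 0 ∧
    ∃ p : ℕ, p.Prime ∧ ∃ S : (ℤ × ℤ) × (ℤ × ℤ), diagramSegments p f = {S}

/-- The integer polynomials of degree exactly `n` and height at most `H`. -/
def polys (n H : ℕ) : Set ℤ[X] :=
  {f | f.degree = (n : WithBot ℕ) ∧ height f ≤ H}

/-- `P_n(H)`: the number of integer polynomials of degree `n` and height at most `H`. -/
def P (n H : ℕ) : ℕ := (polys n H).ncard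

/-- `I_n(H)`: the number of those that are irreducible (over `ℚ`). -/
def I (n H : ℕ) : ℕ :=
  {f ∈ polys n H | Irreducible (f.map (Int.castRingHom ℚ))}.ncard

/-- `D_n(H)`: the number of those that are Dumas polynomials. -/
def D (n H : ℕ) : ℕ := {f ∈ polys n H | IsDumas f}.ncard

/-- The constant `τ_n` for `n ≥ 2`; the value `ζ(n - 1)` is real for `n ≥ 3`. -/
def tau (n : ℕ) : ℝ :=
  if n = 2 then
    1 - ∏' p : Nat.Primes, (1 - 1 / ((p : ℕ) : ℝ)) ^ 2 * (1 + 2 / ((p : ℕ) : ℝ))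
  else
    1 - 1 / (riemannZeta ((n : ℂ) - 1)).re

/-- The infinite product in `tau 2` converges, so `∏'` is not a default value. -/
theorem multipliable_tau_two :
    Multipliable fun p : Nat.Primes =>
      (1 - 1 / ((p : ℕ) : ℝ)) ^ 2 * (1 + 2 / ((p : ℕ) : ℝ)) := by
  have hs : Summable fun p : Nat.Primes => 5 * (1 / ((p : ℕ) : ℝ) ^ 2) :=
    ((Real.summable_one_div_nat_pow.mpr one_lt_two).comp_injective
      Subtype.val_injective).mul_left 5
  have h : Summable fun p : Nat.Primes =>
      ‖(-3 / ((p : ℕ) : ℝ) ^ 2 + 2 / ((p : ℕ) : ℝ) ^ 3)‖ := by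
    refine Summable.of_nonneg_of_le (fun _ => norm_nonneg _) (fun p => ?_) hs
    have h1 : (1 : ℝ) ≤ ((p : ℕ) : ℝ) := by exact_mod_cast p.2.one_lt.le
    have h0 : (0 : ℝ) < ((p : ℕ) : ℝ) := by linarith
    have h3 : 1 / ((p : ℕ) : ℝ) ^ 3 ≤ 1 / ((p : ℕ) : ℝ) ^ 2 :=
      one_div_le_one_div_of_le (by positivity) (pow_le_pow_right₀ h1 (by norm_num))
    have h4 : 0 < 1 / ((p : ℕ) : ℝ) ^ 3 := by positivity
    have e : -3 / ((p : ℕ) : ℝ) ^ 2 + 2 / ((p : ℕ) : ℝ) ^ 3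
        = -3 * (1 / ((p : ℕ) : ℝ) ^ 2) + 2 * (1 / ((p : ℕ) : ℝ) ^ 3) := by ring
    rw [e, Real.norm_eq_abs, abs_le]
    constructor <;> linarith
  refine (multipliable_one_add_of_summable h).congr fun p => ?_
  have h0 : ((p : ℕ) : ℝ) ≠ 0 := by exact_mod_cast p.2.ne_zero
  field_simp
  ring

end DumasCount

end

/-!
A Dumas polynomial of degree `n ≥ 2` has, for the prime `p` in question, all its middle coefficients
and at least one of its two extreme coefficients divisible by `p`: the Newton diagram is one segment
without interior lattice points, so it is not horizontal, and every coefficient point except the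
lower end point lies strictly above height `0`
(`dvd_coeff_of_diagramSegments_eq_singleton`).

Hence the coefficient vector of a Dumas polynomial lies in an excluded set of at most `2 p` residue
vectors modulo some prime `p`. For the primes `p < y`, the Chinese remainder theorem shows that the
vectors avoiding all excluded sets have density at least `∏ (1 - 2 / p ^ n)`
(`le_card_box_filter_forall_residue`). A prime `p ≥ y` divides two coefficients, one of them a nonzero
extreme coefficient, so `p ≤ H`, and summing over `p` these polynomials have density `O(1 / y)`
(`D_le`). Comparing the factors with those of the Euler product of `1 - τ_n` gives
`1 - τ_n ≤ ∏ (1 - 2 / p ^ n)` (`one_sub_tau_le_prod`), and letting `y` tend to infinity gives the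
bound `τ_n` for the upper density (`limsup_D_div_P_le`). The infinite product is positive, so
`τ_n < 1`.

Almost all polynomials are irreducible, because the Mahler measure is multiplicative: the factors of
a reducible polynomial have Mahler measures `a, b ≥ 1` with `a * b ≤ (n + 1) * H`, and a dyadic count
of such pairs gives `O(H ^ n * log H)` reducible polynomials (`ncard_not_irreducible_le`). Thus
dividing by `I n H` instead of `P n H` changes nothing in the limit.
-/

namespace DumasCount

open Polynomial Finset Filter Topology NNReal

/-! ### Divisibility conditions satisfied by Dumas polynomials -/

/-- A segment starts at every vertex of the diagram that is not the last one; hence, if there is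
only one segment, only one vertex has a vertex to its right. -/
theorem eq_fst_of_diagramSegments_eq_singleton {p : ℕ} {f : ℤ[X]} {S : (ℤ × ℤ) × (ℤ × ℤ)}
    (hS : diagramSegments p f = {S}) {Q R : ℤ × ℤ} (hQ : Q ∈ diagramVertices p f)
    (hR : R ∈ diagramVertices p f) (hQR : Q.1 < R.1) : Q = S.1 := by
  obtain ⟨T, ⟨hT, hQT⟩, hmin⟩ :=
    (measure fun R : ℤ × ℤ => (R.1 - Q.1).toNat).wf.has_min
      {R | R ∈ diagramVertices p f ∧ Q.1 < R.1} ⟨R, hR, hQR⟩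
  have hmem : (Q, T) ∈ diagramSegments p f := by
    refine ⟨hQ, hT, hQT, fun U hU ⟨h₁, h₂⟩ => hmin U ⟨hU, h₁⟩ ?_⟩
    change (U.1 - Q.1).toNat < (T.1 - Q.1).toNat
    dsimp only at h₁ h₂ hQT
    omega
  rw [hS, Set.mem_singleton_iff] at hmem
  rw [← hmem]

theorem exists_isNext {p : ℕ} {f : ℤ[X]} {i : ℕ}
    (h : ∃ j ∈ f.support, i < j ∧ NoPointBelow p f i j) : ∃ j, IsNext p f i j := by
  classical
  obtain ⟨j, hj, hij, hb⟩ := h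
  have hne : (f.support.filter fun j => i < j ∧ NoPointBelow p f i j).Nonempty :=
    ⟨j, by simp only [mem_filter]; exact ⟨hj, hij, hb⟩⟩
  have hmax := Finset.isGreatest_max' _ hne
  simp only [coe_filter] at hmax
  exact ⟨_, hmax⟩

/-- If the points to the left of `i` lie on or above the backward extension of every chord from `i`
to the right, then the broken line continues: a chord of minimal slope has no point below it. -/
theorem exists_isNext_of_left {p : ℕ} {f : ℤ[X]} {i : ℕ} (h : ∃ j ∈ f.support, i < j)
    (hleft : ∀ m ∈ f.support, m < i → ∀ k ∈ f.support, i < k →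
      (expo p f i - expo p f m) * ((k : ℤ) - i) ≤ (expo p f k - expo p f i) * ((i : ℤ) - m)) :
    ∃ j, IsNext p f i j := by
  obtain ⟨j₀, hj₀, hij₀⟩ := h
  obtain ⟨j, hj, hmin⟩ := (f.support.filter (i < ·)).exists_min_image
    (fun j => ((expo p f j - expo p f i : ℤ) : ℚ) / ((j : ℚ) - i))
    ⟨j₀, by simpa only [mem_filter] using ⟨hj₀, hij₀⟩⟩
  simp only [mem_filter] at hj hmin
  refine exists_isNext ⟨j, hj.1, hj.2, fun k hk => ?_⟩
  rcases lt_trichotomy i k with hik | rfl | hki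
  · have h := hmin k ⟨hk, hik⟩
    have hj' : (0 : ℚ) < (j : ℚ) - i := by simpa using hj.2
    have hk' : (0 : ℚ) < (k : ℚ) - i := by simpa using hik
    rw [div_le_div_iff₀ hj' hk'] at h
    exact_mod_cast h
  · simp
  · linarith [hleft k hk hki j hj.1 hj.2]

/-- A polynomial whose Newton diagram with respect to `p` is a single segment has all its middle
coefficients, and at least one of its two extreme coefficients, divisible by `p`. -/
theorem dvd_coeff_of_diagramSegments_eq_singleton {p n : ℕ} {f : ℤ[X]} (hn : 2 ≤ n)
    (hdeg : f.natDegree = n) (h0 : f.coeff 0 ≠ 0) {S : (ℤ × ℤ) × (ℤ × ℤ)}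
    (hS : diagramSegments p f = {S}) :
    (∀ i, 0 < i → i < n → (p : ℤ) ∣ f.coeff i) ∧ ((p : ℤ) ∣ f.coeff 0 ∨ (p : ℤ) ∣ f.coeff n) := by
  have hf : f ≠ 0 := by rintro rfl; simp at h0
  have hnmem : n ∈ f.support := by rw [← hdeg]; exact natDegree_mem_support_of_nonzero hf
  obtain ⟨j, hj⟩ : ∃ j, IsNext p f 0 j :=
    exists_isNext_of_left ⟨n, hnmem, by omega⟩ (fun m _ hm => absurd hm (Nat.not_lt_zero m))
  have h0j : 0 < j := hj.1.2.1
  have hjn : j ≤ n := hdeg ▸ le_natDegree_of_mem_supp j hj.1.1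
  have hbelow := hj.1.2.2
  have hv0 : ((0 : ℤ), expo p f 0) ∈ diagramVertices p f :=
    ⟨0, j, .start, hj, by simp, by simp, by simp⟩
  have hvj : ((j : ℤ), expo p f j) ∈ diagramVertices p f :=
    ⟨0, j, .start, hj, by simp, by simp, by simp⟩
  have hS0 := eq_fst_of_diagramSegments_eq_singleton hS hv0 hvj (by simpa using h0j)
  -- If `j < n`, then the broken line continues beyond `j` and a second segment starts there.
  obtain rfl : j = n := by
    by_contra hne
    obtain ⟨k, hk⟩ : ∃ k, IsNext p f j k := by
      refine exists_isNext_of_left ⟨n, hnmem, by omega⟩ fun m hm hmj k hk hjk => ?_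
      have h₁ := hbelow k hk
      have h₂ := hbelow m hm
      have hj' : (0 : ℤ) < j := by exact_mod_cast h0j
      have h₃ : (0 : ℤ) ≤ (j : ℤ) - m := by omega
      have h₄ : (0 : ℤ) ≤ (k : ℤ) - j := by omega
      refine le_of_mul_le_mul_right ?_ hj'
      have e₁ := mul_le_mul_of_nonneg_right h₁ h₃
      have e₂ := mul_le_mul_of_nonneg_right h₂ h₄
      push_cast at e₁ e₂
      nlinarith
    have hvk : ((k : ℤ), expo p f k) ∈ diagramVertices p f :=
      ⟨j, k, .step 0 j .start hj, hk, by simpa using hk.1.2.1.le, by simp, by ring⟩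
    have := eq_fst_of_diagramSegments_eq_singleton hS hvj hvk (by simpa using hk.1.2.1)
    rw [← this] at hS0
    simp only [Prod.mk.injEq] at hS0
    omega
  have hdvd : ∀ k, (f.coeff k ≠ 0 → 0 < expo p f k) → (p : ℤ) ∣ f.coeff k := by
    intro k hk
    by_cases hk0 : f.coeff k = 0
    · simp [hk0]
    · have := hk hk0
      rw [expo, Nat.cast_pos] at this
      exact (dvd_pow_self (p : ℤ) this.ne').trans (padicValInt_dvd (f.coeff k))
  have hnn : ∀ k, 0 ≤ expo p f k := fun k => Int.natCast_nonneg _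
  have hj2 : (2 : ℤ) ≤ j := by exact_mod_cast hn
  rcases lt_trichotomy (expo p f 0) (expo p f j) with hlt | heq | hgt
  · have key : ∀ k, 0 < k → (p : ℤ) ∣ f.coeff k := fun k hk => hdvd k fun hk0 => by
      have h := hbelow k (mem_support_iff.mpr hk0)
      have hk' : (0 : ℤ) < k := by exact_mod_cast hk
      push_cast at h
      have : 0 < (expo p f k - expo p f 0) * ((j : ℤ) - 0) :=
        lt_of_lt_of_le (mul_pos (by linarith) (by linarith)) h
      have := pos_of_mul_pos_left this (by linarith)
      linarith [hnn 0]
    exact ⟨fun i hi _ => key i hi, Or.inr (key j h0j)⟩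
  · -- A horizontal segment contains a further lattice point, as `n ≥ 2`.
    have hv1 : ((1 : ℤ), expo p f 0) ∈ diagramVertices p f :=
      ⟨0, j, .start, hj, by simp, by linarith, by simp [heq]⟩
    have := eq_fst_of_diagramSegments_eq_singleton hS hv1 hvj (by dsimp only; omega)
    rw [← this] at hS0
    simp at hS0
  · have key : ∀ k, k < j → (p : ℤ) ∣ f.coeff k := fun k hk => hdvd k fun hk0 => by
      have h := hbelow k (mem_support_iff.mpr hk0)
      have hk' : (k : ℤ) < j := by exact_mod_cast hk
      push_cast at h
      have : 0 < (expo p f k - expo p f j) * (j : ℤ) := by nlinarith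
      have := pos_of_mul_pos_left this (by linarith)
      linarith [hnn j]
    exact ⟨fun i _ hi => key i hi, Or.inl (key 0 h0j)⟩

/-! ### Counting integer vectors in a box by residues -/

/-- The integer vectors with all entries of absolute value at most `H`. -/
noncomputable def box (ι : Type*) [Fintype ι] [DecidableEq ι] (H : ℕ) : Finset (ι → ℤ) :=
  Fintype.piFinset fun _ => Icc (-(H : ℤ)) H

theorem card_Icc_neg_self (H : ℕ) : #(Icc (-(H : ℤ)) H) = 2 * H + 1 := by
  rw [Int.card_Icc]
  omega

theorem card_box (ι : Type*) [Fintype ι] [DecidableEq ι] (H : ℕ) :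
    #(box ι H) = (2 * H + 1) ^ Fintype.card ι := by
  rw [box, Fintype.card_piFinset, prod_const, card_Icc_neg_self, card_univ]

/-- Every residue class modulo `q` has `(2H + 1) / q + O(1)` members in `[-H, H]`. -/
theorem card_residue_mem_Icc (H : ℕ) {q : ℕ} (hq : 0 < q) (v : ℤ) :
    (2 * (H : ℝ) + 1 - q) / q ≤ #{x ∈ Icc (-(H : ℤ)) H | ((x : ℤ) : ZMod q) = v} ∧
      (#{x ∈ Icc (-(H : ℤ)) H | ((x : ℤ) : ZMod q) = v} : ℝ) ≤ (2 * (H : ℝ) + 1 + q) / q := by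
  have hI : Icc (-(H : ℤ)) H = Ico (-(H : ℤ)) (H + 1) := by
    ext x
    simp only [mem_Icc, mem_Ico]
    omega
  have hcard : (#{x ∈ Icc (-(H : ℤ)) H | ((x : ℤ) : ZMod q) = v} : ℤ) =
      max (⌈((H + 1 : ℤ) - v) / (q : ℚ)⌉ - ⌈((-H : ℤ) - v) / (q : ℚ)⌉) 0 := by
    have h := Int.Ico_filter_modEq_card (-(H : ℤ)) (H + 1) (r := q) (by exact_mod_cast hq) v
    simp only [hI, ZMod.intCast_eq_intCast_iff]
    simpa using h
  have hqQ : (0 : ℚ) < q := by exact_mod_cast hq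
  have h₁ := Int.le_ceil (((H + 1 : ℤ) - v) / (q : ℚ))
  have h₂ := Int.ceil_lt_add_one (((H + 1 : ℤ) - v) / (q : ℚ))
  have h₃ := Int.le_ceil (((-H : ℤ) - v) / (q : ℚ))
  have h₄ := Int.ceil_lt_add_one (((-H : ℤ) - v) / (q : ℚ))
  have hcQ : (#{x ∈ Icc (-(H : ℤ)) H | ((x : ℤ) : ZMod q) = v} : ℚ) =
      max ((⌈((H + 1 : ℤ) - v) / (q : ℚ)⌉ : ℚ) - ⌈((-H : ℤ) - v) / (q : ℚ)⌉) 0 := by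
    exact_mod_cast congrArg (Int.cast : ℤ → ℚ) hcard
  have e₁ : (2 * (H : ℚ) + 1 - q) / q =
      ((H + 1 : ℤ) - v) / (q : ℚ) - (((-H : ℤ) - v) / (q : ℚ) + 1) := by
    push_cast
    field_simp
    ring
  have e₂ : (2 * (H : ℚ) + 1 + q) / q =
      (((H + 1 : ℤ) - v) / (q : ℚ) + 1) - ((-H : ℤ) - v) / (q : ℚ) := by
    push_cast
    field_simp
    ring
  have k₁ : (2 * (H : ℚ) + 1 - q) / q ≤ #{x ∈ Icc (-(H : ℤ)) H | ((x : ℤ) : ZMod q) = v} := by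
    rw [hcQ, e₁]
    refine le_max_of_le_left ?_
    linarith
  have k₂ : (#{x ∈ Icc (-(H : ℤ)) H | ((x : ℤ) : ZMod q) = v} : ℚ) ≤
      (2 * (H : ℚ) + 1 + q) / q := by
    rw [hcQ]
    refine max_le ?_ (by positivity)
    rw [e₂]
    linarith
  have r₁ := (Rat.cast_le (K := ℝ)).mpr k₁
  have r₂ := (Rat.cast_le (K := ℝ)).mpr k₂
  push_cast at r₁ r₂
  exact ⟨r₁, r₂⟩

/-- Each residue vector in `G` has at least `((2H + 1) / q - 1) ^ |ι|` lifts to the box. -/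
theorem le_card_box_filter_residue {ι : Type*} [Fintype ι] [DecidableEq ι] (H : ℕ) {q : ℕ}
    (hq : 0 < q) (hqH : q ≤ 2 * H + 1) (G : Finset (ι → ZMod q)) :
    (#G : ℝ) * ((2 * (H : ℝ) + 1 - q) / q) ^ Fintype.card ι ≤
      #{x ∈ box ι H | (fun i => ((x i : ℤ) : ZMod q)) ∈ G} := by
  have hqH' : (q : ℝ) ≤ 2 * H + 1 := by exact_mod_cast hqH
  have hfib := card_eq_sum_card_fiberwise
    (s := {x ∈ box ι H | (fun i => ((x i : ℤ) : ZMod q)) ∈ G}) (t := G)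
    (f := fun x i => ((x i : ℤ) : ZMod q)) fun x hx => (mem_filter.mp hx).2
  rw [hfib, Nat.cast_sum, ← nsmul_eq_mul]
  refine card_nsmul_le_sum _ _ _ fun g hg => ?_
  have hset : {x ∈ {x ∈ box ι H | (fun i => ((x i : ℤ) : ZMod q)) ∈ G} |
        (fun i => ((x i : ℤ) : ZMod q)) = g} =
      Fintype.piFinset fun i => {x ∈ Icc (-(H : ℤ)) H | ((x : ℤ) : ZMod q) = g i} := by
    ext x
    simp only [box, mem_filter, Fintype.mem_piFinset]
    constructor
    · rintro ⟨⟨h, -⟩, rfl⟩ i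
      exact ⟨h i, rfl⟩
    · intro h
      have hx : (fun i => ((x i : ℤ) : ZMod q)) = g := funext fun i => (h i).2
      exact ⟨⟨fun i => (h i).1, hx ▸ hg⟩, hx⟩
  rw [hset, Fintype.card_piFinset, Nat.cast_prod, ← card_univ, ← prod_const]
  refine prod_le_prod (fun i _ => div_nonneg (by linarith) (by positivity)) fun i _ => ?_
  obtain ⟨v, hv⟩ := ZMod.intCast_surjective (g i)
  rw [← hv]
  exact (card_residue_mem_Icc H hq v).1

/-- By the Chinese remainder theorem, conditions modulo pairwise coprime moduli are independent: the
density of the vectors satisfying all of them is the product of the individual densities, up to the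
error from the boundary of the box. -/
theorem le_card_box_filter_forall_residue {ι κ : Type*} [Fintype ι] [DecidableEq ι] [Fintype κ]
    [DecidableEq κ] (a : κ → ℕ) (ha : ∀ k, 0 < a k) (hcop : Pairwise (Function.onFun Nat.Coprime a))
    (G : ∀ k, Finset (ι → ZMod (a k))) (H : ℕ) (hH : ∏ k, a k ≤ 2 * H + 1) :
    (∏ k, (#(G k) : ℝ) / (a k : ℝ) ^ Fintype.card ι) *
        (2 * (H : ℝ) + 1 - ((∏ k, a k : ℕ) : ℝ)) ^ Fintype.card ι ≤
      #{x ∈ box ι H | ∀ k, (fun i => ((x i : ℤ) : ZMod (a k))) ∈ G k} := by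
  let E := ZMod.prodEquivPi a hcop
  let e : (ι → ZMod (∏ k, a k)) ≃ (∀ k, ι → ZMod (a k)) :=
    (Equiv.piCongrRight fun _ => E.toEquiv).trans (Equiv.piComm fun _ k => ZMod (a k))
  have he : ∀ (x : ι → ℤ) k,
      e (fun i => ((x i : ℤ) : ZMod (∏ k, a k))) k = fun i => ((x i : ℤ) : ZMod (a k)) := by
    intro x k
    funext i
    change E ((x i : ℤ) : ZMod (∏ k, a k)) k = _
    rw [map_intCast, Pi.intCast_apply]
  have h := le_card_box_filter_residue H (prod_pos fun k _ => ha k) hH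
    ((Fintype.piFinset G).map e.symm.toEmbedding)
  have hmem : ∀ x : ι → ℤ, (fun i => ((x i : ℤ) : ZMod (∏ k, a k))) ∈
      (Fintype.piFinset G).map e.symm.toEmbedding ↔
      ∀ k, (fun i => ((x i : ℤ) : ZMod (a k))) ∈ G k := by
    intro x
    rw [mem_map_equiv, Equiv.symm_symm, Fintype.mem_piFinset]
    simp only [he]
  simp only [hmem, card_map, Fintype.card_piFinset] at h
  refine le_trans (le_of_eq ?_) h
  rw [prod_div_distrib, div_pow, prod_pow]
  push_cast
  ring

/-- For `d ≤ H`, a proportion `O(1 / d ^ 2)` of the vectors in a box has two given coordinates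
divisible by `d`. The condition `d ≤ H` absorbs the class of `0`, which would otherwise contribute
even for large `d`. -/
theorem card_box_filter_dvd_dvd_le {n H d : ℕ} (hd : 0 < d) (hdH : d ≤ H) {i j : Fin (n + 1)}
    (hij : i ≠ j) :
    (#{x ∈ box (Fin (n + 1)) H | (d : ℤ) ∣ x i ∧ (d : ℤ) ∣ x j} : ℝ) ≤
      (4 * (H : ℝ) / d) ^ 2 * (2 * (H : ℝ) + 1) ^ (n - 1) := by
  have hset : {x ∈ box (Fin (n + 1)) H | (d : ℤ) ∣ x i ∧ (d : ℤ) ∣ x j} =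
      Fintype.piFinset fun k => if k ∈ ({i, j} : Finset (Fin (n + 1))) then
        {x ∈ Icc (-(H : ℤ)) H | ((x : ℤ) : ZMod d) = (0 : ℤ)} else Icc (-(H : ℤ)) H := by
    ext x
    simp only [box, mem_filter, Fintype.mem_piFinset, mem_insert, mem_singleton, Int.cast_zero,
      ZMod.intCast_zmod_eq_zero_iff_dvd]
    constructor
    · rintro ⟨h, hi, hj⟩ k
      split_ifs with hk
      · rw [mem_filter]
        rcases hk with rfl | rfl
        · exact ⟨h _, hi⟩
        · exact ⟨h _, hj⟩
      · exact h k
    · intro h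
      refine ⟨fun k => ?_, ?_, ?_⟩
      · have := h k
        split_ifs at this with hk
        · exact (mem_filter.mp this).1
        · exact this
      · have := h i
        rw [if_pos (Or.inl rfl)] at this
        exact (mem_filter.mp this).2
      · have := h j
        rw [if_pos (Or.inr rfl)] at this
        exact (mem_filter.mp this).2
  have hM := (card_residue_mem_Icc H hd 0).2
  have hM' : (2 * (H : ℝ) + 1 + d) / d ≤ 4 * (H : ℝ) / d := by
    have h1 : (1 : ℝ) ≤ H := by exact_mod_cast hd.trans_le hdH
    have h2 : (d : ℝ) ≤ H := by exact_mod_cast hdH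
    gcongr
    linarith
  have hpair : #({i, j} : Finset (Fin (n + 1))) = 2 := card_pair hij
  rw [hset, Fintype.card_piFinset]
  simp only [apply_ite Finset.card, prod_ite, prod_const, filter_mem_eq_inter, univ_inter,
    filter_notMem_eq_sdiff, card_univ_sdiff, hpair, Fintype.card_fin, card_Icc_neg_self]
  push_cast
  gcongr
  simpa using hM.trans hM'

/-! ### The upper bound for the number of Dumas polynomials -/

theorem height_le_iff {f : ℤ[X]} {H : ℕ} : height f ≤ H ↔ ∀ i, (f.coeff i).natAbs ≤ H := by
  rw [height, Finset.sup_le_iff]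
  refine ⟨fun h i => ?_, fun h i _ => h i⟩
  by_cases hi : i < f.natDegree + 1
  · exact h i (mem_range.mpr hi)
  · rw [coeff_eq_zero_of_natDegree_lt (by omega)]
    simp

theorem mem_polys_iff {n H : ℕ} {f : ℤ[X]} (hn : 0 < n) :
    f ∈ polys n H ↔ f.natDegree = n ∧ ∀ i, (f.coeff i).natAbs ≤ H := by
  rw [polys, Set.mem_ofPred_eq, degree_eq_iff_natDegree_eq_of_pos hn, height_le_iff]

/-- The residue vectors modulo `p` whose lifts cannot be Dumas with respect to `p`, according to
`dvd_coeff_of_diagramSegments_eq_singleton`: those which are not of the shape `(x₀, 0, …, 0)` or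
`(0, …, 0, xₙ)`. -/
noncomputable def goodResidues (n p : ℕ) [NeZero p] : Finset (Fin (n + 1) → ZMod p) := by
  classical exact
  {x | ¬ ((∀ i, i ≠ 0 → i ≠ Fin.last n → x i = 0) ∧ (x 0 = 0 ∨ x (Fin.last n) = 0))}

theorem mem_goodResidues {n p : ℕ} [NeZero p] {x : Fin (n + 1) → ZMod p} :
    x ∈ goodResidues n p ↔
      ¬ ((∀ i, i ≠ 0 → i ≠ Fin.last n → x i = 0) ∧ (x 0 = 0 ∨ x (Fin.last n) = 0)) := by
  simp [goodResidues]

theorem le_card_goodResidues (n p : ℕ) [NeZero p] :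
    p ^ (n + 1) ≤ #(goodResidues n p) + 2 * p := by
  classical
  have hsub : (univ : Finset (Fin (n + 1) → ZMod p)) ⊆ goodResidues n p ∪
      (univ.image (fun t : ZMod p => Pi.single (0 : Fin (n + 1)) t) ∪
        univ.image (fun t : ZMod p => Pi.single (Fin.last n) t)) := by
    intro x _
    by_cases hx : x ∈ goodResidues n p
    · exact mem_union_left _ hx
    rw [mem_goodResidues, not_not] at hx
    obtain ⟨hmid, h0 | hlast⟩ := hx
    · refine mem_union_right _ (mem_union_right _ (mem_image.mpr ⟨x (Fin.last n), mem_univ _, ?_⟩))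
      funext i
      by_cases hi : i = Fin.last n
      · subst hi; simp
      · rw [Pi.single_eq_of_ne hi]
        by_cases hi0 : i = 0
        · rw [hi0, h0]
        · rw [hmid i hi0 hi]
    · refine mem_union_right _ (mem_union_left _ (mem_image.mpr ⟨x 0, mem_univ _, ?_⟩))
      funext i
      by_cases hi : i = 0
      · subst hi; simp
      · rw [Pi.single_eq_of_ne hi]
        by_cases hil : i = Fin.last n
        · rw [hil, hlast]
        · rw [hmid i hi hil]
  have h := card_le_card hsub
  rw [card_univ, Fintype.card_fun, ZMod.card, Fintype.card_fin] at h
  refine h.trans ((card_union_le _ _).trans ?_)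
  gcongr
  refine (card_union_le _ _).trans ?_
  have h₁ := card_image_le (s := univ) (f := fun t : ZMod p => (Pi.single 0 t : Fin (n + 1) → ZMod p))
  have h₂ := card_image_le (s := univ) (f := fun t : ZMod p => (Pi.single (Fin.last n) t : Fin (n + 1) → ZMod p))
  rw [card_univ, ZMod.card] at h₁ h₂
  convert (add_le_add h₁ h₂).trans_eq (two_mul p).symm

/-- Dumas polynomials with respect to a prime below `y` fail the sieve by these primes; those with
respect to a larger prime have two coefficients divisible by it. -/
theorem D_le {n : ℕ} (hn : 2 ≤ n) {y : ℕ} (hy : 0 < y) {H : ℕ}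
    (hH : ∏ p ∈ y.primesBelow, p ≤ 2 * H + 1) :
    (D n H : ℝ) ≤ (2 * (H : ℝ) + 1) ^ (n + 1) -
      (∏ p ∈ y.primesBelow, (1 - 2 / (p : ℝ) ^ n)) *
        (2 * (H : ℝ) + 1 - ((∏ p ∈ y.primesBelow, p : ℕ) : ℝ)) ^ (n + 1) +
      16 / (y : ℝ) * (2 * (H : ℝ) + 1) ^ (n + 1) := by
  classical
  let κ := {p // p ∈ y.primesBelow}
  have hprime : ∀ k : κ, (k : ℕ).Prime := fun k => Nat.prime_of_mem_primesBelow k.2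
  have : ∀ k : κ, NeZero (k : ℕ) := fun k => ⟨(hprime k).ne_zero⟩
  have hprod : ∏ k : κ, (k : ℕ) = ∏ p ∈ y.primesBelow, p :=
    prod_coe_sort y.primesBelow fun p => p
  let B := box (Fin (n + 1)) H
  let good : Finset (Fin (n + 1) → ℤ) :=
    {x ∈ B | ∀ k : κ, (fun i => ((x i : ℤ) : ZMod (k : ℕ))) ∈ goodResidues n (k : ℕ)}
  let tail : Finset (Fin (n + 1) → ℤ) := (Ioo (y - 1) (H + 1)).biUnion fun p =>
    {x ∈ B | (p : ℤ) ∣ x 1 ∧ (p : ℤ) ∣ x 0} ∪ {x ∈ B | (p : ℤ) ∣ x 1 ∧ (p : ℤ) ∣ x (Fin.last n)}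
  have h1val : ((1 : Fin (n + 1)) : ℕ) = 1 := by
    rw [Fin.val_one', Nat.mod_eq_of_lt (by omega)]
  have h10 : (1 : Fin (n + 1)) ≠ 0 := fun h => by
    have := congrArg Fin.val h
    rw [h1val, Fin.val_zero] at this
    omega
  have h1n : (1 : Fin (n + 1)) ≠ Fin.last n := fun h => by
    have := congrArg Fin.val h
    rw [h1val, Fin.val_last] at this
    omega
  have hgood : (∏ p ∈ y.primesBelow, (1 - 2 / (p : ℝ) ^ n)) *
      (2 * (H : ℝ) + 1 - ((∏ p ∈ y.primesBelow, p : ℕ) : ℝ)) ^ (n + 1) ≤ #good := by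
    have h := le_card_box_filter_forall_residue (ι := Fin (n + 1)) (κ := κ) (fun k => (k : ℕ))
      (fun k => (hprime k).pos)
      (fun k l hkl => (Nat.coprime_primes (hprime k) (hprime l)).mpr fun h => hkl (Subtype.ext h))
      (fun k => goodResidues n (k : ℕ)) H (by rw [hprod]; exact hH)
    rw [hprod, Fintype.card_fin] at h
    refine le_trans ?_ h
    have h0 : (0 : ℝ) ≤ 2 * (H : ℝ) + 1 - ((∏ p ∈ y.primesBelow, p : ℕ) : ℝ) := by
      rw [sub_nonneg]; exact_mod_cast hH
    refine mul_le_mul_of_nonneg_right ?_ (pow_nonneg h0 _)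
    rw [← prod_coe_sort y.primesBelow fun p => 1 - 2 / (p : ℝ) ^ n]
    refine prod_le_prod (fun k _ => ?_) fun k _ => ?_
    · have h2 : (2 : ℝ) ≤ (k : ℕ) := by exact_mod_cast (hprime k).two_le
      have : (2 : ℝ) ≤ ((k : ℕ) : ℝ) ^ n :=
        h2.trans (le_self_pow₀ (by linarith) (by omega))
      have : 2 / ((k : ℕ) : ℝ) ^ n ≤ 1 := by rw [div_le_one] <;> linarith
      linarith
    · have hk : (0 : ℝ) < (k : ℕ) := by exact_mod_cast (hprime k).pos
      have h := le_card_goodResidues n (k : ℕ)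
      have h' : ((k : ℕ) : ℝ) ^ (n + 1) ≤ #(goodResidues n (k : ℕ)) + 2 * (k : ℕ) := by
        exact_mod_cast h
      rw [le_div_iff₀ (by positivity)]
      have e : (1 - 2 / ((k : ℕ) : ℝ) ^ n) * ((k : ℕ) : ℝ) ^ (n + 1) =
          ((k : ℕ) : ℝ) ^ (n + 1) - 2 * (k : ℕ) := by
        rw [pow_succ]
        field_simp
      linarith
  -- Each `p` contributes at most `2 * (4 * H / p) ^ 2 * (2 * H + 1) ^ (n - 1)` vectors.
  have htail : (#tail : ℝ) ≤ 16 / (y : ℝ) * (2 * (H : ℝ) + 1) ^ (n + 1) := by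
    have hterm : ∀ p ∈ Ioo (y - 1) (H + 1),
        (#({x ∈ B | (p : ℤ) ∣ x 1 ∧ (p : ℤ) ∣ x 0} ∪
          {x ∈ B | (p : ℤ) ∣ x 1 ∧ (p : ℤ) ∣ x (Fin.last n)}) : ℝ) ≤
        ((p : ℝ) ^ 2)⁻¹ * (8 * (2 * (H : ℝ) + 1) ^ (n + 1)) := by
      intro p hp
      rw [mem_Ioo] at hp
      have h₁ := card_box_filter_dvd_dvd_le (n := n) (H := H) (d := p) (by omega) (by omega) h10
      have h₂ := card_box_filter_dvd_dvd_le (n := n) (H := H) (d := p) (by omega) (by omega) h1n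
      have h₃ : (#({x ∈ B | (p : ℤ) ∣ x 1 ∧ (p : ℤ) ∣ x 0} ∪
          {x ∈ B | (p : ℤ) ∣ x 1 ∧ (p : ℤ) ∣ x (Fin.last n)}) : ℝ) ≤
          #{x ∈ B | (p : ℤ) ∣ x 1 ∧ (p : ℤ) ∣ x 0} +
          #{x ∈ B | (p : ℤ) ∣ x 1 ∧ (p : ℤ) ∣ x (Fin.last n)} := by
        exact_mod_cast card_union_le _ _
      refine h₃.trans ((add_le_add h₁ h₂).trans ?_)
      have hp0 : (0 : ℝ) < p := by exact_mod_cast (by omega : 0 < p)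
      have e : (4 * (H : ℝ) / p) ^ 2 * (2 * (H : ℝ) + 1) ^ (n - 1) +
          (4 * (H : ℝ) / p) ^ 2 * (2 * (H : ℝ) + 1) ^ (n - 1) =
          ((p : ℝ) ^ 2)⁻¹ * (8 * ((2 * (H : ℝ)) ^ 2 * (2 * (H : ℝ) + 1) ^ (n - 1))) := by
        field_simp
        ring
      rw [e, show n + 1 = 2 + (n - 1) by omega, pow_add]
      gcongr
      linarith
    calc (#tail : ℝ) ≤ ∑ p ∈ Ioo (y - 1) (H + 1),
          (#({x ∈ B | (p : ℤ) ∣ x 1 ∧ (p : ℤ) ∣ x 0} ∪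
            {x ∈ B | (p : ℤ) ∣ x 1 ∧ (p : ℤ) ∣ x (Fin.last n)}) : ℝ) := by
          exact_mod_cast card_biUnion_le
      _ ≤ ∑ p ∈ Ioo (y - 1) (H + 1), ((p : ℝ) ^ 2)⁻¹ * (8 * (2 * (H : ℝ) + 1) ^ (n + 1)) :=
          sum_le_sum hterm
      _ = (∑ p ∈ Ioo (y - 1) (H + 1), ((p : ℝ) ^ 2)⁻¹) * (8 * (2 * (H : ℝ) + 1) ^ (n + 1)) :=
          (sum_mul _ _ _).symm
      _ ≤ (2 / (((y - 1 : ℕ) : ℝ) + 1)) * (8 * (2 * (H : ℝ) + 1) ^ (n + 1)) := by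
          gcongr
          exact sum_Ioo_inv_sq_le (y - 1) (H + 1)
      _ = _ := by
          rw [Nat.cast_sub (by omega), Nat.cast_one]
          ring
  have hD : D n H ≤ #((B \ good) ∪ tail) := by
    rw [D, ← Set.ncard_coe_finset]
    refine Set.ncard_le_ncard_of_injOn (fun f i => f.coeff i) ?_ ?_ (finite_toSet _)
    · rintro f ⟨hf, -, h0, p, hp, S, hS⟩
      rw [mem_polys_iff (by omega)] at hf
      have hB : (fun i : Fin (n + 1) => f.coeff i) ∈ B := by
        rw [show B = box (Fin (n + 1)) H from rfl, box, Fintype.mem_piFinset]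
        intro i
        have := hf.2 i
        rw [mem_Icc]
        omega
      obtain ⟨hmid, hend⟩ := dvd_coeff_of_diagramSegments_eq_singleton hn hf.1 h0 hS
      have hlead : f.coeff n ≠ 0 := by
        rw [← hf.1]
        exact leadingCoeff_ne_zero.mpr (by rintro rfl; simp at h0)
      rw [mem_coe, mem_union]
      by_cases hpy : p < y
      · left
        refine mem_sdiff.mpr ⟨hB, fun hg => ?_⟩
        have h := (mem_filter.mp hg).2 ⟨p, Nat.mem_primesBelow.mpr ⟨hpy, hp⟩⟩
        rw [mem_goodResidues] at h
        simp only [ZMod.intCast_zmod_eq_zero_iff_dvd] at h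
        refine h ⟨fun i hi0 hin => hmid i (Nat.pos_of_ne_zero fun h => hi0 (Fin.ext h)) ?_, hend⟩
        have hi := i.2
        have : (i : ℕ) ≠ n := fun h => hin (Fin.ext h)
        omega
      · right
        -- A nonzero extreme coefficient is divisible by `p`, which bounds `p`.
        have hpH : ∀ i, f.coeff i ≠ 0 → (p : ℤ) ∣ f.coeff i → p ≤ H := fun i hi hd =>
          (Nat.le_of_dvd (Int.natAbs_pos.mpr hi) (Int.natCast_dvd.mp hd)).trans (hf.2 i)
        have hp1 : (p : ℤ) ∣ f.coeff ((1 : Fin (n + 1)) : ℕ) := by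
          rw [h1val]; exact hmid 1 one_pos (by omega)
        have hpH' : p ≤ H := hend.elim (hpH 0 h0) (hpH n hlead)
        refine mem_biUnion.mpr ⟨p, mem_Ioo.mpr ⟨by omega, by omega⟩, ?_⟩
        rcases hend with h | h
        · exact mem_union_left _ (mem_filter.mpr ⟨hB, hp1, h⟩)
        · exact mem_union_right _ (mem_filter.mpr ⟨hB, hp1, h⟩)
    · rintro f ⟨hf, -⟩ g ⟨hg, -⟩ hfg
      rw [mem_polys_iff (by omega)] at hf hg
      ext i
      by_cases hi : i < n + 1
      · exact congrFun hfg ⟨i, hi⟩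
      · rw [coeff_eq_zero_of_natDegree_lt (by omega), coeff_eq_zero_of_natDegree_lt (by omega)]
  have hcard : (D n H : ℝ) ≤ ((2 * (H : ℝ) + 1) ^ (n + 1) - #good) + #tail := by
    have h₁ : #(B \ good) + #good = (2 * H + 1) ^ (n + 1) := by
      rw [card_sdiff_add_card_eq_card (filter_subset _ _), card_box, Fintype.card_fin]
    have h₂ := hD.trans (card_union_le _ _)
    have h₁' : (#(B \ good) : ℝ) + #good = (2 * (H : ℝ) + 1) ^ (n + 1) := by exact_mod_cast h₁
    have h₂' : (D n H : ℝ) ≤ #(B \ good) + #tail := by exact_mod_cast h₂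
    linarith
  linarith

/-! ### Almost all integer polynomials are irreducible -/

/-- Gauss's lemma: an integer polynomial of positive degree which is reducible over `ℚ` is a product
of two integer polynomials of positive degree. -/
theorem exists_mul_of_not_irreducible_map {f : ℤ[X]} (hf : 0 < f.natDegree)
    (hirr : ¬ Irreducible (f.map (Int.castRingHom ℚ))) :
    ∃ g h : ℤ[X], f = g * h ∧ 0 < g.natDegree ∧ 0 < h.natDegree := by
  have hf0 : f ≠ 0 := by rintro rfl; simp at hf
  have hc : f.content ≠ 0 := by rwa [Ne, content_eq_zero_iff]
  have hcQ : IsUnit (C ((Int.castRingHom ℚ) f.content)) :=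
    isUnit_C.mpr (isUnit_iff_ne_zero.mpr (by simpa using hc))
  have hprim := f.isPrimitive_primPart
  have hmap : f.map (Int.castRingHom ℚ) =
      C ((Int.castRingHom ℚ) f.content) * f.primPart.map (Int.castRingHom ℚ) := by
    conv_lhs => rw [f.eq_C_content_mul_primPart]
    rw [Polynomial.map_mul, map_C]
  have hnirr : ¬ Irreducible f.primPart := by
    rw [IsPrimitive.Int.irreducible_iff_irreducible_map_cast hprim]
    rwa [hmap, irreducible_isUnit_mul hcQ] at hirr
  have hnu : ¬ IsUnit f.primPart := fun hu => by
    have := natDegree_eq_zero_of_isUnit hu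
    rw [natDegree_primPart] at this
    omega
  have hpos : ∀ g h : ℤ[X], f.primPart = g * h → ¬ IsUnit g → 0 < g.natDegree := by
    intro g h hgh hg
    by_contra h0
    have hgC := eq_C_of_natDegree_eq_zero (Nat.eq_zero_of_not_pos h0)
    refine hg ?_
    rw [hgC]
    exact isUnit_C.mpr (hprim _ ⟨h, by rw [← hgC]; exact hgh⟩)
  obtain ⟨g, h, hgh, hg, hh⟩ : ∃ g h, f.primPart = g * h ∧ ¬ IsUnit g ∧ ¬ IsUnit h := by
    by_contra hno
    push Not at hno
    refine hnirr ⟨hnu, fun {a b} hab => ?_⟩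
    by_cases ha : IsUnit a
    · exact Or.inl ha
    · exact Or.inr (hno a b hab ha)
  refine ⟨C f.content * g, h, ?_, ?_, hpos h g (hgh.trans (mul_comm _ _)) hh⟩
  · rw [mul_assoc, ← hgh]
    exact f.eq_C_content_mul_primPart
  · rw [natDegree_C_mul hc]
    exact hpos g h hgh hg

/-- The integer polynomials of degree at most `k` and Mahler measure at most `B`. -/
def mahlerBall (k : ℕ) (B : ℝ≥0) : Set ℤ[X] :=
  {f | f.natDegree ≤ k ∧ (f.map (Int.castRingHom ℂ)).mahlerMeasure ≤ B}

theorem ncard_mahlerBall_le {n k : ℕ} (hk : k ≤ n) {B : ℝ≥0} (hB : 1 ≤ B) :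
    ((mahlerBall k B).ncard : ℝ) ≤ ((2 ^ (n + 1) + 1) * (B : ℝ)) ^ (k + 1) := by
  have h : ((mahlerBall k B).ncard : ℝ) ≤
      ∏ i : Fin (k + 1), (2 * (⌊(k.choose i : ℝ≥0) * B⌋₊ : ℝ) + 1) := by
    exact_mod_cast card_mahlerMeasure_le_prod k B
  refine h.trans ?_
  calc ∏ i : Fin (k + 1), (2 * (⌊(k.choose i : ℝ≥0) * B⌋₊ : ℝ) + 1)
      ≤ ∏ _i : Fin (k + 1), ((2 ^ (n + 1) + 1) * (B : ℝ)) := by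
        refine prod_le_prod (fun i _ => by positivity) fun i _ => ?_
        have h₁ : (⌊(k.choose i : ℝ≥0) * B⌋₊ : ℝ) ≤ (k.choose i : ℝ) * B := by
          exact_mod_cast Nat.floor_le (zero_le (a := (k.choose i : ℝ≥0) * B))
        have h₂ : (k.choose i : ℝ) ≤ 2 ^ n := by
          exact_mod_cast (Nat.choose_le_two_pow k i).trans (Nat.pow_le_pow_right two_pos hk)
        have hB' : (1 : ℝ) ≤ B := by exact_mod_cast hB
        have h₃ : (k.choose i : ℝ) * B ≤ 2 ^ n * B := by gcongr
        rw [pow_succ]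
        linarith
    _ = _ := by rw [prod_const, card_univ, Fintype.card_fin]

theorem mahlerMeasure_le_of_mem_polys {n H : ℕ} (hn : 0 < n) {f : ℤ[X]} (hf : f ∈ polys n H) :
    (f.map (Int.castRingHom ℂ)).mahlerMeasure ≤ (((n + 1) * H : ℕ) : ℝ) := by
  rw [mem_polys_iff hn] at hf
  refine (mahlerMeasure_le_sum_norm_coeff _).trans ?_
  rw [sum_over_range' _ (fun _ => norm_zero) (n + 1)
    (by have := natDegree_map_le (f := Int.castRingHom ℂ) (p := f); omega)]
  calc ∑ i ∈ range (n + 1), ‖(f.map (Int.castRingHom ℂ)).coeff i‖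
      ≤ ∑ _i ∈ range (n + 1), (H : ℝ) := by
        refine sum_le_sum fun i _ => ?_
        rw [coeff_map, eq_intCast, Complex.norm_intCast, ← Int.cast_abs, Int.abs_eq_natAbs]
        exact_mod_cast hf.2 i
    _ = _ := by simp

/-- The number of reducible polynomials of degree `n` and height at most `H` is
`O(H ^ n * log H)`. The Mahler measures of the two factors of such a polynomial are at least `1` and
their product is at most `(n + 1) * H`; the pairs of factors are counted in dyadic ranges for the
Mahler measure of the first one. -/
theorem ncard_not_irreducible_le {n H : ℕ} (hn : 2 ≤ n) (hH : 0 < H) :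
    ({f ∈ polys n H | ¬ Irreducible (f.map (Int.castRingHom ℚ))}.ncard : ℝ) ≤
      n * (Nat.log 2 ((n + 1) * H) + 1) *
        ((2 * (2 ^ (n + 1) + 1)) ^ (n + 2) * (((n + 1) * H : ℕ) : ℝ) ^ n) := by
  set X : ℕ := (n + 1) * H with hX
  have hX0 : 0 < X := by positivity
  let T : Finset (ℕ × ℕ) := Ioo 0 n ×ˢ range (Nat.log 2 X + 1)
  let S : ℕ × ℕ → Set ℤ[X] := fun t => (fun u : ℤ[X] × ℤ[X] => u.1 * u.2) ''
    (mahlerBall t.1 (2 ^ (t.2 + 1)) ×ˢ mahlerBall (n - t.1) (X / 2 ^ t.2))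
  have hfin : ∀ t : ℕ × ℕ, (mahlerBall t.1 (2 ^ (t.2 + 1)) ×ˢ
      mahlerBall (n - t.1) ((X : ℝ≥0) / 2 ^ t.2)).Finite := fun t =>
    (finite_mahlerMeasure_le _ _).prod (finite_mahlerMeasure_le _ _)
  have hsub : {f ∈ polys n H | ¬ Irreducible (f.map (Int.castRingHom ℚ))} ⊆ ⋃ t ∈ T, S t := by
    rintro f ⟨hf, hirr⟩
    have hM := mahlerMeasure_le_of_mem_polys (by omega) hf
    rw [← hX] at hM
    have hdeg := ((mem_polys_iff (by omega)).mp hf).1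
    obtain ⟨g, h, rfl, hg, hh⟩ := exists_mul_of_not_irreducible_map (by omega) hirr
    have hg0 : g ≠ 0 := by rintro rfl; simp at hg
    have hh0 : h ≠ 0 := by rintro rfl; simp at hh
    rw [natDegree_mul hg0 hh0] at hdeg
    have hg1 := one_le_mahlerMeasure_of_ne_zero hg0
    have hh1 := one_le_mahlerMeasure_of_ne_zero hh0
    rw [Polynomial.map_mul, mahlerMeasure_mul] at hM
    set a := (g.map (Int.castRingHom ℂ)).mahlerMeasure
    set b := (h.map (Int.castRingHom ℂ)).mahlerMeasure
    have haX : a ≤ X := by nlinarith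
    have hfl : ⌊a⌋₊ ≠ 0 := (Nat.floor_pos.mpr hg1).ne'
    have hj₁ : (2 : ℝ) ^ Nat.log 2 ⌊a⌋₊ ≤ a := by
      refine le_trans ?_ (Nat.floor_le (by linarith))
      exact_mod_cast Nat.pow_log_le_self 2 hfl
    have hj₂ : a ≤ (2 : ℝ) ^ (Nat.log 2 ⌊a⌋₊ + 1) := by
      refine (Nat.lt_floor_add_one a).le.trans ?_
      exact_mod_cast Nat.lt_pow_succ_log_self one_lt_two ⌊a⌋₊
    refine Set.mem_biUnion (x := (g.natDegree, Nat.log 2 ⌊a⌋₊)) ?_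
      ⟨(g, h), ⟨⟨le_rfl, ?_⟩, ⟨?_, ?_⟩⟩, rfl⟩
    · refine mem_product.mpr ⟨mem_Ioo.mpr ⟨hg, by dsimp only; omega⟩, mem_range.mpr ?_⟩
      dsimp only
      exact Nat.lt_succ_of_le (Nat.log_mono_right (Nat.floor_le_of_le haX))
    · push_cast
      exact hj₂
    · dsimp only
      omega
    · push_cast
      rw [le_div_iff₀ (by positivity)]
      refine le_trans ?_ hM
      rw [mul_comm]
      gcongr
  -- With `A = 2 ^ j` and `B = X / 2 ^ j`, the pairs of factors of degrees `k` and `n - k` number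
  -- `O(A ^ (k + 1) * B ^ (n - k + 1))`, and both exponents are at most `n`, while `A * B = X`.
  have hcard : ∀ t ∈ T, ((S t).ncard : ℝ) ≤
      (2 * (2 ^ (n + 1) + 1)) ^ (n + 2) * (X : ℝ) ^ n := by
    intro t ht
    obtain ⟨hk, hj⟩ := mem_product.mp ht
    rw [mem_Ioo] at hk
    rw [mem_range, Nat.lt_succ_iff] at hj
    have h2X : 2 ^ t.2 ≤ X :=
      (Nat.pow_le_pow_right two_pos hj).trans (Nat.pow_log_le_self 2 hX0.ne')
    have hA : (1 : ℝ) ≤ 2 ^ t.2 := one_le_pow₀ one_le_two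
    have hB : (1 : ℝ) ≤ X / 2 ^ t.2 := by
      rw [one_le_div (by positivity)]
      exact_mod_cast h2X
    have h₀ : (S t).ncard ≤
        (mahlerBall t.1 (2 ^ (t.2 + 1))).ncard * (mahlerBall (n - t.1) (X / 2 ^ t.2)).ncard := by
      rw [← Set.ncard_prod]
      exact Set.ncard_image_le (hfin t)
    have h₁ := ncard_mahlerBall_le (n := n) (k := t.1) (B := 2 ^ (t.2 + 1)) hk.2.le
      (one_le_pow₀ one_le_two)
    have h₂ := ncard_mahlerBall_le (n := n) (k := n - t.1) (B := X / 2 ^ t.2) (Nat.sub_le _ _)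
      (by exact_mod_cast hB)
    push_cast at h₁ h₂
    calc ((S t).ncard : ℝ)
        ≤ (mahlerBall t.1 (2 ^ (t.2 + 1))).ncard *
          (mahlerBall (n - t.1) (X / 2 ^ t.2)).ncard := by exact_mod_cast h₀
      _ ≤ ((2 ^ (n + 1) + 1) * (2 : ℝ) ^ (t.2 + 1)) ^ (t.1 + 1) *
          ((2 ^ (n + 1) + 1) * ((X : ℝ) / 2 ^ t.2)) ^ (n - t.1 + 1) := by gcongr
      _ ≤ ((2 * (2 ^ (n + 1) + 1)) * (2 : ℝ) ^ t.2) ^ (t.1 + 1) *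
          ((2 * (2 ^ (n + 1) + 1)) * ((X : ℝ) / 2 ^ t.2)) ^ (n - t.1 + 1) := by
          have e : (2 ^ (n + 1) + 1) * (2 : ℝ) ^ (t.2 + 1) =
              (2 * (2 ^ (n + 1) + 1)) * (2 : ℝ) ^ t.2 := by ring
          rw [e]
          gcongr
          have : (0 : ℝ) < 2 ^ (n + 1) + 1 := by positivity
          linarith
      _ = (2 * (2 ^ (n + 1) + 1)) ^ (n + 2) *
          (((2 : ℝ) ^ t.2) ^ (t.1 + 1) * ((X : ℝ) / 2 ^ t.2) ^ (n - t.1 + 1)) := by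
          rw [mul_pow, mul_pow _ ((X : ℝ) / 2 ^ t.2), mul_mul_mul_comm, ← pow_add]
          congr 2
          omega
      _ ≤ (2 * (2 ^ (n + 1) + 1)) ^ (n + 2) *
          (((2 : ℝ) ^ t.2) ^ n * ((X : ℝ) / 2 ^ t.2) ^ n) := by
          have i₁ := pow_le_pow_right₀ hA (show t.1 + 1 ≤ n by omega)
          have i₂ := pow_le_pow_right₀ hB (show n - t.1 + 1 ≤ n by omega)
          gcongr
      _ = _ := by
          rw [← mul_pow ((2 : ℝ) ^ t.2), mul_div_cancel₀ _ (by positivity)]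
  have hfinU : (⋃ t ∈ T, S t).Finite := T.finite_toSet.biUnion fun t _ => (hfin t).image _
  calc ({f ∈ polys n H | ¬ Irreducible (f.map (Int.castRingHom ℚ))}.ncard : ℝ)
      ≤ (⋃ t ∈ T, S t).ncard := by exact_mod_cast Set.ncard_le_ncard hsub hfinU
    _ ≤ ∑ t ∈ T, ((S t).ncard : ℝ) := by exact_mod_cast Finset.set_ncard_biUnion_le T S
    _ ≤ ∑ t ∈ T, (2 * (2 ^ (n + 1) + 1)) ^ (n + 2) * (X : ℝ) ^ n := sum_le_sum hcard
    _ = #T * ((2 * (2 ^ (n + 1) + 1)) ^ (n + 2) * (X : ℝ) ^ n) := by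
        rw [sum_const, nsmul_eq_mul]
    _ ≤ _ := by
        gcongr
        have : #T ≤ n * (Nat.log 2 X + 1) := by
          rw [card_product, Nat.card_Ioo, card_range]
          gcongr
          omega
        exact_mod_cast this

/-- There are `2 H (2 H + 1) ^ n` polynomials of degree `n` and height at most `H`: those of degree
at most `n` without those of degree at most `n - 1`. -/
theorem finite_polys_and_P_eq {n : ℕ} (hn : 0 < n) (H : ℕ) :
    (polys n H).Finite ∧ P n H = 2 * H * (2 * H + 1) ^ n := by
  have hmem : ∀ m (f : ℤ[X]), f ∈ boxPoly m (fun _ => -(H : ℝ)) (fun _ => (H : ℝ)) ↔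
      f.natDegree ≤ m ∧ ∀ i, (f.coeff i).natAbs ≤ H := by
    intro m f
    rw [boxPoly, Set.mem_ofPred_eq]
    refine and_congr_right fun hdeg => ⟨fun h i => ?_, fun h i => ?_⟩
    · by_cases hi : i < m + 1
      · have := h ⟨i, hi⟩
        have h₁ : -(H : ℤ) ≤ f.coeff i := by exact_mod_cast this.1
        have h₂ : f.coeff i ≤ (H : ℤ) := by exact_mod_cast this.2
        omega
      · rw [coeff_eq_zero_of_natDegree_lt (by omega)]
        simp
    · have := h i
      have h₁ : -(H : ℤ) ≤ f.coeff i := by omega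
      have h₂ : f.coeff i ≤ (H : ℤ) := by omega
      exact ⟨by exact_mod_cast h₁, by exact_mod_cast h₂⟩
  have hcard : ∀ m, (boxPoly m (fun _ => -(H : ℝ)) (fun _ => (H : ℝ))).ncard =
      (2 * H + 1) ^ (m + 1) := by
    intro m
    rw [ncard_boxPoly]
    simp only [Int.floor_natCast, Int.ceil_neg, prod_const, card_univ, Fintype.card_fin]
    congr 1
    omega
  have hset : polys n H = boxPoly n (fun _ => -(H : ℝ)) (fun _ => H) \
      boxPoly (n - 1) (fun _ => -(H : ℝ)) (fun _ => H) := by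
    ext f
    rw [mem_polys_iff hn, Set.mem_sdiff, hmem, hmem]
    constructor
    · rintro ⟨h₁, h₂⟩
      exact ⟨⟨h₁.le, h₂⟩, fun h => by omega⟩
    · rintro ⟨⟨h₁, h₂⟩, h₃⟩
      refine ⟨?_, h₂⟩
      by_contra hne
      exact h₃ ⟨by omega, h₂⟩
  have hfin : ∀ m, (boxPoly m (fun _ => -(H : ℝ)) (fun _ => (H : ℝ))).Finite := fun m =>
    Set.finite_of_ncard_ne_zero (by rw [hcard]; positivity)
  refine ⟨hset ▸ (hfin n).sdiff, ?_⟩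
  rw [P, hset, Set.ncard_sdiff _ (hfin _), hcard, hcard, Nat.sub_add_cancel hn, pow_succ]
  · rw [mul_add, mul_one, Nat.add_sub_cancel]
    ring
  · intro f hf
    rw [hmem] at hf ⊢
    exact ⟨by omega, hf.2⟩

/-! ### The constant `τ_n` as an Euler product -/

theorem one_sub_one_div_pow_pos {k p : ℕ} (hk : k ≠ 0) (hp : p.Prime) :
    0 < 1 - 1 / (p : ℝ) ^ k := by
  have h1 : (1 : ℝ) < p := by exact_mod_cast hp.one_lt
  have := one_lt_pow₀ h1 hk
  have : 1 / (p : ℝ) ^ k < 1 := by rw [div_lt_one] <;> linarith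
  linarith

/-- The truncated products `∏ (1 - p⁻ᵏ)⁻¹` increase to `ζ(k)`. -/
theorem prod_primesBelow_le_riemannZeta_re {k : ℕ} (hk : 2 ≤ k) (y : ℕ) :
    ∏ p ∈ y.primesBelow, (1 - 1 / (p : ℝ) ^ k)⁻¹ ≤ (riemannZeta (k : ℂ)).re := by
  have hs : 1 < ((k : ℂ)).re := by simpa using (by omega : 1 < k)
  have ht := (Complex.continuous_re.tendsto _).comp (riemannZeta_eulerProduct hs)
  have hcongr : (Complex.re ∘ fun n : ℕ => ∏ p ∈ n.primesBelow, (1 - (p : ℂ) ^ (-(k : ℂ)))⁻¹) =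
      fun n : ℕ => ∏ p ∈ n.primesBelow, (1 - 1 / (p : ℝ) ^ k)⁻¹ := by
    funext n
    have : ∏ p ∈ n.primesBelow, (1 - (p : ℂ) ^ (-(k : ℂ)))⁻¹ =
        ((∏ p ∈ n.primesBelow, (1 - 1 / (p : ℝ) ^ k)⁻¹ : ℝ) : ℂ) := by
      push_cast
      refine prod_congr rfl fun p _ => ?_
      rw [Complex.cpow_neg, Complex.cpow_natCast, one_div]
    simp only [Function.comp_apply, this, Complex.ofReal_re]
  rw [hcongr] at ht
  refine Monotone.ge_of_tendsto (monotone_nat_of_le_succ fun m => ?_) ht y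
  have hpos : 0 ≤ ∏ p ∈ m.primesBelow, (1 - 1 / (p : ℝ) ^ k)⁻¹ :=
    prod_nonneg fun p hp =>
      inv_nonneg.mpr (one_sub_one_div_pow_pos (by omega) (Nat.prime_of_mem_primesBelow hp)).le
  rw [Nat.primesBelow_succ]
  split_ifs with hm
  · rw [prod_insert (Nat.notMem_primesBelow m)]
    refine le_mul_of_one_le_left hpos ?_
    refine (one_le_inv₀ (one_sub_one_div_pow_pos (by omega) hm)).mpr ?_
    have : 0 ≤ 1 / (m : ℝ) ^ k := by positivity
    linarith
  · exact le_rfl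

/-- The factors of the product for `1 - τ_2` are positive and at most those of the sieve. -/
theorem factor_two_bounds {p : ℕ} (hp : p.Prime) :
    0 < (1 - 1 / (p : ℝ)) ^ 2 * (1 + 2 / (p : ℝ)) ∧
      (1 - 1 / (p : ℝ)) ^ 2 * (1 + 2 / (p : ℝ)) ≤ 1 - 2 / (p : ℝ) ^ 2 := by
  have h2 : (2 : ℝ) ≤ p := by exact_mod_cast hp.two_le
  have h0 : (0 : ℝ) < p := by linarith
  constructor
  · have : 1 / (p : ℝ) < 1 := by rw [div_lt_one h0]; linarith
    have : 0 < 1 - 1 / (p : ℝ) := by linarith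
    positivity
  · have e : 1 - 2 / (p : ℝ) ^ 2 - (1 - 1 / (p : ℝ)) ^ 2 * (1 + 2 / (p : ℝ)) =
        (p - 2) / (p : ℝ) ^ 3 := by
      field_simp
      ring
    have : 0 ≤ (p - 2) / (p : ℝ) ^ 3 := div_nonneg (by linarith) (by positivity)
    linarith

theorem tau_two : tau 2 = 1 - ∏' p : Nat.Primes,
    (1 - 1 / ((p : ℕ) : ℝ)) ^ 2 * (1 + 2 / ((p : ℕ) : ℝ)) := by
  simp [tau]

theorem tau_of_three_le {n : ℕ} (hn : 3 ≤ n) :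
    tau n = 1 - 1 / (riemannZeta ((n - 1 : ℕ) : ℂ)).re := by
  rw [tau, if_neg (by omega), Nat.cast_sub (by omega), Nat.cast_one]

theorem summable_log_factor_two : Summable fun p : Nat.Primes =>
    Real.log ((1 - 1 / ((p : ℕ) : ℝ)) ^ 2 * (1 + 2 / ((p : ℕ) : ℝ))) := by
  have hs : Summable fun p : Nat.Primes => 3 * (1 / ((p : ℕ) : ℝ) ^ 2) :=
    ((Real.summable_one_div_nat_pow.mpr one_lt_two).comp_injective
      Subtype.val_injective).mul_left 3
  have h := Real.summable_log_one_add_of_summable (ι := Nat.Primes)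
    (f := fun p => (1 - 1 / ((p : ℕ) : ℝ)) ^ 2 * (1 + 2 / ((p : ℕ) : ℝ)) - 1) ?_
  · simpa using h
  refine Summable.of_norm_bounded hs fun p => ?_
  have h2 : (2 : ℝ) ≤ ((p : ℕ) : ℝ) := by exact_mod_cast p.2.two_le
  have h0 : (0 : ℝ) < ((p : ℕ) : ℝ) := by linarith
  have h1 := (factor_two_bounds p.2).2
  have e : (1 - 1 / ((p : ℕ) : ℝ)) ^ 2 * (1 + 2 / ((p : ℕ) : ℝ)) - 1 =
      - (3 * (1 / ((p : ℕ) : ℝ) ^ 2)) + 2 / ((p : ℕ) : ℝ) ^ 3 := by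
    field_simp
    ring
  have h3 : 0 < 2 / ((p : ℕ) : ℝ) ^ 2 := by positivity
  have h4 : 0 < 2 / ((p : ℕ) : ℝ) ^ 3 := by positivity
  rw [Real.norm_eq_abs, abs_le]
  constructor
  · linarith
  · have : 0 < 1 / ((p : ℕ) : ℝ) ^ 2 := by positivity
    linarith

theorem tau_lt_one {n : ℕ} (hn : 2 ≤ n) : tau n < 1 := by
  rcases hn.eq_or_lt with rfl | hn
  · rw [tau_two, ← Real.rexp_tsum_eq_tprod (fun p => (factor_two_bounds p.2).1)
      summable_log_factor_two]
    linarith [Real.exp_pos (∑' p : Nat.Primes,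
      Real.log ((1 - 1 / ((p : ℕ) : ℝ)) ^ 2 * (1 + 2 / ((p : ℕ) : ℝ))))]
  · rw [tau_of_three_le hn]
    have h := prod_primesBelow_le_riemannZeta_re (k := n - 1) (by omega) 0
    have : Nat.primesBelow 0 = ∅ := rfl
    rw [this, prod_empty] at h
    have : 0 < 1 / (riemannZeta ((n - 1 : ℕ) : ℂ)).re := by positivity
    linarith

/-- The density of the vectors surviving the sieve by the primes below `y` is at least `1 - τ_n`. -/
theorem one_sub_tau_le_prod {n : ℕ} (hn : 2 ≤ n) (y : ℕ) :
    1 - tau n ≤ ∏ p ∈ y.primesBelow, (1 - 2 / (p : ℝ) ^ n) := by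
  rcases hn.eq_or_lt with rfl | hn
  · have hpos := fun p : Nat.Primes => (factor_two_bounds p.2).1
    have hsum : ∀ s : Finset Nat.Primes,
        ∑' p : Nat.Primes, Real.log ((1 - 1 / ((p : ℕ) : ℝ)) ^ 2 * (1 + 2 / ((p : ℕ) : ℝ))) ≤
          ∑ p ∈ s, Real.log ((1 - 1 / ((p : ℕ) : ℝ)) ^ 2 * (1 + 2 / ((p : ℕ) : ℝ))) := by
      intro s
      have h := summable_log_factor_two.neg.sum_le_tsum s fun p _ => ?_
      · rw [tsum_neg, sum_neg_distrib] at h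
        exact neg_le_neg_iff.mp h
      · refine neg_nonneg.mpr (Real.log_nonpos (hpos p).le ?_)
        have : 0 ≤ 2 / ((p : ℕ) : ℝ) ^ 2 := by positivity
        linarith [(factor_two_bounds p.2).2]
    rw [tau_two, sub_sub_cancel, ← Real.rexp_tsum_eq_tprod hpos summable_log_factor_two]
    calc Real.exp (∑' p : Nat.Primes,
          Real.log ((1 - 1 / ((p : ℕ) : ℝ)) ^ 2 * (1 + 2 / ((p : ℕ) : ℝ))))
        ≤ Real.exp (∑ p ∈ (range y).subtype Nat.Prime,
          Real.log ((1 - 1 / ((p : ℕ) : ℝ)) ^ 2 * (1 + 2 / ((p : ℕ) : ℝ)))) := by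
          refine Real.exp_le_exp.mpr ?_
          exact hsum _
      _ = ∏ p ∈ (range y).subtype Nat.Prime,
          ((1 - 1 / ((p : ℕ) : ℝ)) ^ 2 * (1 + 2 / ((p : ℕ) : ℝ))) := by
          rw [Real.exp_sum]
          exact prod_congr rfl fun p _ => Real.exp_log (hpos p)
      _ = ∏ p ∈ y.primesBelow, ((1 - 1 / (p : ℝ)) ^ 2 * (1 + 2 / (p : ℝ))) :=
          prod_subtype_eq_prod_filter fun p : ℕ => (1 - 1 / (p : ℝ)) ^ 2 * (1 + 2 / (p : ℝ))
      _ ≤ _ := prod_le_prod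
          (fun p hp => (factor_two_bounds (Nat.prime_of_mem_primesBelow hp)).1.le)
          (fun p hp => (factor_two_bounds (Nat.prime_of_mem_primesBelow hp)).2)
  · rw [tau_of_three_le hn, sub_sub_cancel]
    have h := prod_primesBelow_le_riemannZeta_re (k := n - 1) (by omega) y
    have hpos := fun p hp => one_sub_one_div_pow_pos (k := n - 1) (p := p) (by omega)
      (Nat.prime_of_mem_primesBelow (n := y) hp)
    rw [prod_inv_distrib] at h
    calc 1 / (riemannZeta ((n - 1 : ℕ) : ℂ)).re
        ≤ ∏ p ∈ y.primesBelow, (1 - 1 / (p : ℝ) ^ (n - 1)) := by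
          rw [one_div]
          exact inv_le_of_inv_le₀ (prod_pos hpos) h
      _ ≤ _ := by
          refine prod_le_prod (fun p hp => (hpos p hp).le) fun p hp => ?_
          have h2 : (2 : ℝ) ≤ p := by exact_mod_cast (Nat.prime_of_mem_primesBelow hp).two_le
          have h0 : (0 : ℝ) < p := by linarith
          have : 2 / (p : ℝ) ^ n ≤ 1 / (p : ℝ) ^ (n - 1) := by
            obtain ⟨m, rfl⟩ : ∃ m, n = m + 1 := ⟨n - 1, by omega⟩
            rw [div_le_div_iff₀ (by positivity) (by positivity), Nat.add_sub_cancel, pow_succ]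
            have : 0 < (p : ℝ) ^ m := by positivity
            nlinarith
          linarith

/-! ### Upper densities -/

/-- Stated as an inequality; exchanging `u` and `w` shows that the two limsups agree. -/
theorem limsup_coe_le_of_tendsto_sub {u w : ℕ → ℝ} (h : Tendsto (fun H => w H - u H) atTop (𝓝 0)) :
    limsup (fun H => (w H : EReal)) atTop ≤ limsup (fun H => (u H : EReal)) atTop := by
  have hlim : limsup (fun H => ((w H - u H : ℝ) : EReal)) atTop = 0 :=
    (EReal.tendsto_coe.mpr h).limsup_eq
  have hadd : (fun H => (w H : EReal)) =
      (fun H => (u H : EReal)) + fun H => ((w H - u H : ℝ) : EReal) := by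
    funext H
    rw [Pi.add_apply, ← EReal.coe_add, add_sub_cancel]
  calc limsup (fun H => (w H : EReal)) atTop
      ≤ limsup (fun H => (u H : EReal)) atTop +
        limsup (fun H => ((w H - u H : ℝ) : EReal)) atTop := by
        rw [hadd]
        exact EReal.limsup_add_le (Or.inr (by rw [hlim]; exact EReal.zero_ne_top))
          (Or.inr (by rw [hlim]; exact EReal.zero_ne_bot))
    _ = _ := by rw [hlim, add_zero]

theorem P_pos {n H : ℕ} (hn : 0 < n) (hH : 0 < H) : 0 < P n H := by
  rw [(finite_polys_and_P_eq hn H).2]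
  positivity

theorem D_le_P {n : ℕ} (hn : 0 < n) (H : ℕ) : D n H ≤ P n H :=
  Set.ncard_le_ncard (fun _ hf => hf.1) (finite_polys_and_P_eq hn H).1

theorem tendsto_I_div_P {n : ℕ} (hn : 2 ≤ n) :
    Tendsto (fun H : ℕ => (I n H : ℝ) / P n H) atTop (𝓝 1) := by
  let R : ℕ → ℕ := fun H => {f ∈ polys n H | ¬ Irreducible (f.map (Int.castRingHom ℚ))}.ncard
  have hsum : ∀ H, I n H + R H = P n H := by
    intro H
    have hfin := (finite_polys_and_P_eq (by omega : 0 < n) H).1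
    rw [I, P, ← Set.ncard_union_eq (Set.disjoint_left.mpr fun f hf hf' => hf'.2 hf.2)
      (hfin.subset fun _ hf => hf.1) (hfin.subset fun _ hf => hf.1)]
    congr 1
    ext f
    simp only [Set.mem_union, Set.mem_ofPred_eq]
    tauto
  let K : ℝ := n * (2 * (2 ^ (n + 1) + 1)) ^ (n + 2) * (n + 1) ^ n
  have hbound : ∀ H : ℕ, 0 < H → (R H : ℝ) / P n H ≤
      K * (n + 1) * ((Real.log (((n + 1) * H : ℕ) : ℝ) / (((n + 1) * H : ℕ) : ℝ)) / Real.log 2 +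
        (((n + 1) * H : ℕ) : ℝ)⁻¹) := by
    intro H hH
    have hH' : (0 : ℝ) < H := by exact_mod_cast hH
    have hlog : (Nat.log 2 ((n + 1) * H) : ℝ) ≤
        Real.log (((n + 1) * H : ℕ) : ℝ) / Real.log 2 := by
      have := Real.natLog_le_logb ((n + 1) * H) 2
      rwa [Real.logb, Nat.cast_two] at this
    have hP : (P n H : ℝ) = 2 * H * (2 * H + 1) ^ n := by
      exact_mod_cast (finite_polys_and_P_eq (by omega : 0 < n) H).2
    have hP' : (H : ℝ) * H ^ n ≤ P n H := by
      rw [hP]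
      gcongr <;> linarith
    have hL : 0 ≤ Real.log (((n + 1) * H : ℕ) : ℝ) / Real.log 2 :=
      (Nat.cast_nonneg _).trans hlog
    calc (R H : ℝ) / P n H
        ≤ (n * (Real.log (((n + 1) * H : ℕ) : ℝ) / Real.log 2 + 1) *
          ((2 * (2 ^ (n + 1) + 1)) ^ (n + 2) * (((n + 1) * H : ℕ) : ℝ) ^ n)) / (H * H ^ n) := by
          gcongr
          refine (ncard_not_irreducible_le hn hH).trans ?_
          gcongr
      _ = _ := by
          simp only [K]
          push_cast
          field_simp
          rw [mul_pow]
          ring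
  have hX : Tendsto (fun H : ℕ => (((n + 1) * H : ℕ) : ℝ)) atTop atTop :=
    tendsto_natCast_atTop_atTop.comp
      (tendsto_id.const_mul_atTop' (Nat.succ_pos n))
  have h₁ := (Real.isLittleO_log_id_atTop.tendsto_div_nhds_zero).comp hX
  have h₂ := ((h₁.div_const (Real.log 2)).add (tendsto_inv_atTop_zero.comp hX)).const_mul
    (K * (n + 1))
  rw [zero_div, add_zero, mul_zero] at h₂
  have hR : Tendsto (fun H => (R H : ℝ) / P n H) atTop (𝓝 0) := by
    refine squeeze_zero' (Eventually.of_forall fun H => by positivity) ?_ h₂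
    filter_upwards [eventually_gt_atTop 0] with H hH
    exact hbound H hH
  have h₃ := hR.const_sub 1
  rw [sub_zero] at h₃
  refine h₃.congr' ?_
  filter_upwards [eventually_gt_atTop 0] with H hH
  have hP0 : (P n H : ℝ) ≠ 0 := by exact_mod_cast (P_pos (by omega : 0 < n) hH).ne'
  have : (I n H : ℝ) + R H = P n H := by exact_mod_cast hsum H
  rw [eq_div_iff hP0, sub_mul, div_mul_cancel₀ _ hP0]
  linarith

theorem tendsto_D_div_I_sub {n : ℕ} (hn : 2 ≤ n) :
    Tendsto (fun H : ℕ => (D n H : ℝ) / I n H - (D n H : ℝ) / P n H) atTop (𝓝 0) := by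
  have h := (tendsto_I_div_P hn).inv₀ one_ne_zero
  rw [inv_one] at h
  have h' := h.sub_const 1
  rw [sub_self] at h'
  refine squeeze_zero_norm' ?_ (tendsto_zero_iff_norm_tendsto_zero.mp h')
  filter_upwards [eventually_gt_atTop 0] with H hH
  have hP0 : (0 : ℝ) < P n H := by exact_mod_cast P_pos (by omega : 0 < n) hH
  have hDP : (D n H : ℝ) ≤ P n H := by exact_mod_cast D_le_P (by omega : 0 < n) H
  have e : (D n H : ℝ) / I n H - (D n H : ℝ) / P n H =
      (D n H : ℝ) / P n H * (((I n H : ℝ) / P n H)⁻¹ - 1) := by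
    rw [inv_div]
    field_simp
  rw [e, norm_mul]
  refine mul_le_of_le_one_left (norm_nonneg _) ?_
  rw [Real.norm_of_nonneg (by positivity), div_le_one hP0]
  exact hDP

/-- The bound for the upper density obtained from sieving by the primes below `y`. -/
theorem limsup_D_div_P_le_add {n : ℕ} (hn : 2 ≤ n) {y : ℕ} (hy : 0 < y) :
    limsup (fun H : ℕ => (((D n H : ℝ) / (P n H : ℝ) : ℝ) : EReal)) atTop ≤
      ((tau n + 16 / (y : ℝ) : ℝ) : EReal) := by
  set W : ℝ := ∏ p ∈ y.primesBelow, (1 - 2 / (p : ℝ) ^ n) with hW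
  set q : ℕ := ∏ p ∈ y.primesBelow, p with hq
  let v : ℕ → ℝ := fun H =>
    (1 + (H : ℝ)⁻¹ / 2) * (1 - W * (1 - q / (2 * (H : ℝ) + 1)) ^ (n + 1) + 16 / (y : ℝ))
  have hv : Tendsto v atTop (𝓝 ((1 + 0 / 2) * (1 - W * (1 - 0) ^ (n + 1) + 16 / (y : ℝ)))) := by
    have hX : Tendsto (fun H : ℕ => 2 * (H : ℝ) + 1) atTop atTop :=
      tendsto_atTop_add_const_right _ _
        (tendsto_natCast_atTop_atTop.const_mul_atTop two_pos)
    have h₁ : Tendsto (fun H : ℕ => (H : ℝ)⁻¹) atTop (𝓝 0) :=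
      tendsto_inv_atTop_zero.comp tendsto_natCast_atTop_atTop
    have h₂ : Tendsto (fun H : ℕ => (q : ℝ) / (2 * (H : ℝ) + 1)) atTop (𝓝 0) :=
      tendsto_const_nhds.div_atTop hX
    exact ((h₁.div_const 2).const_add 1).mul
      (((((h₂.const_sub 1).pow (n + 1)).const_mul W).const_sub 1).add_const _)
  have hle : ∀ᶠ H : ℕ in atTop, (((D n H : ℝ) / (P n H : ℝ) : ℝ) : EReal) ≤ (v H : EReal) := by
    filter_upwards [eventually_gt_atTop 0, eventually_ge_atTop q] with H hH hqH
    have h := D_le hn hy (H := H) (by rw [← hq]; omega)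
    rw [← hq, ← hW] at h
    have hH' : (0 : ℝ) < H := by exact_mod_cast hH
    have hP : (P n H : ℝ) = 2 * H * (2 * H + 1) ^ n := by
      exact_mod_cast (finite_polys_and_P_eq (by omega : 0 < n) H).2
    have hP0 : (0 : ℝ) < P n H := by rw [hP]; positivity
    refine EReal.coe_le_coe_iff.mpr ?_
    rw [div_le_iff₀ hP0]
    refine h.trans (le_of_eq ?_)
    have e : 1 - (q : ℝ) / (2 * H + 1) = (2 * H + 1 - q) / (2 * H + 1) := by
      field_simp
    simp only [v]
    rw [hP, e, div_pow]
    field_simp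
    ring
  calc limsup (fun H : ℕ => (((D n H : ℝ) / (P n H : ℝ) : ℝ) : EReal)) atTop
      ≤ limsup (fun H : ℕ => (v H : EReal)) atTop := limsup_le_limsup hle
    _ = _ := (EReal.tendsto_coe.mpr hv).limsup_eq
    _ ≤ _ := by
        refine EReal.coe_le_coe_iff.mpr ?_
        have := one_sub_tau_le_prod hn y
        rw [← hW] at this
        rw [sub_zero, one_pow, mul_one, zero_div, add_zero, one_mul]
        linarith

theorem limsup_D_div_P_le {n : ℕ} (hn : 2 ≤ n) :
    limsup (fun H : ℕ => (((D n H : ℝ) / (P n H : ℝ) : ℝ) : EReal)) atTop ≤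
      ((tau n : ℝ) : EReal) := by
  have h : Tendsto (fun y : ℕ => tau n + 16 / (y : ℝ)) atTop (𝓝 (tau n + 0)) :=
    (tendsto_const_nhds.div_atTop tendsto_natCast_atTop_atTop).const_add _
  rw [add_zero] at h
  refine ge_of_tendsto (EReal.tendsto_coe.mpr h) ?_
  filter_upwards [eventually_gt_atTop 0] with y hy
  exact limsup_D_div_P_le_add hn hy

end DumasCount

theorem mainTheorem2 (n : ℕ) (hn : 2 ≤ n) :
    Filter.limsup (fun H : ℕ =>
        (((DumasCount.D n H : ℝ) / (DumasCount.P n H : ℝ) : ℝ) : EReal)) Filter.atTop =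
      Filter.limsup (fun H : ℕ =>
        (((DumasCount.D n H : ℝ) / (DumasCount.I n H : ℝ) : ℝ) : EReal)) Filter.atTop ∧
    Filter.limsup (fun H : ℕ =>
        (((DumasCount.D n H : ℝ) / (DumasCount.P n H : ℝ) : ℝ) : EReal)) Filter.atTop ≤
      ((DumasCount.tau n : ℝ) : EReal) ∧
    Filter.limsup (fun H : ℕ =>
        (((DumasCount.D n H : ℝ) / (DumasCount.I n H : ℝ) : ℝ) : EReal)) Filter.atTop ≤
      ((DumasCount.tau n : ℝ) : EReal) ∧
    DumasCount.tau n < 1 ∧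
    ¬ Filter.Tendsto (fun H : ℕ => (DumasCount.D n H : ℝ) / (DumasCount.I n H : ℝ))
      Filter.atTop (nhds 1) := by
  have hsub := DumasCount.tendsto_D_div_I_sub hn
  have hsub' := hsub.neg
  simp only [neg_sub, neg_zero] at hsub'
  have heq := le_antisymm (DumasCount.limsup_coe_le_of_tendsto_sub hsub')
    (DumasCount.limsup_coe_le_of_tendsto_sub hsub)
  have hP := DumasCount.limsup_D_div_P_le hn
  have hI := heq ▸ hP
  have htau := DumasCount.tau_lt_one hn
  refine ⟨heq, hP, hI, htau, fun h => ?_⟩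
  rw [(EReal.tendsto_coe.mpr h).limsup_eq] at hI
  exact htau.not_ge (EReal.coe_le_coe_iff.mp hI)
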